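/- A pseudo-BCK algebra is a structure $(A,\le,\to,\rightsquigarrow,1)$, where $\le$ is a binary relation on $A$, $\to$ and $\rightsquigarrow$ are binary operations on $A$ and $1\in A$, such that for all $x,y,z\in A$: $x\to y\le (y\to z)\rightsquigarrow(x\to z)$ and $x\rightsquigarrow y\le (y\rightsquigarrow z)\to(x\rightsquigarrow z)$; $x\le (x\to y)\rightsquigarrow y$ and $x\le (x\rightsquigarrow y)\to y$; $x\le x$; $x\le 1$; if $x\le y$ and $y\le x$ then $x=y$; and $x\le y$ iff $x\to y=1$ iff $x\rightsquigarrow y=1$. It is bounded if it has an element $0$ with $0\le x$ for all $x\in A$. Put $x\vee_1 y=(x\to y)\rightsquigarrow y$ and $x\vee_2 y=(x\rightsquigarrow y)\to y$. A filter of $A$ is a set $F\subseteq A$ with $1\in F$ such that $a\in F$ and $a\to b\in F$ imply $b\in F$; it is maximal if $F\ne A$ and $F$ is not properly contained in another filter different from $A$. Let $A$ be a bounded pseudo-BCK algebra. A Bosbach state on $A$ is a function $s:A\to[0,1]$ with $s(0)=0$, $s(1)=1$ and, for all $x,y\in A$, $s(x)+s(x\to y)=s(y)+s(y\to x)$ and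 $s(x)+s(x\rightsquigarrow y)=s(y)+s(y\rightsquigarrow x)$. It is extremal if for all $0<\lambda<1$ and all Bosbach states $s_1,s_2$ on $A$, $s=\lambda s_1+(1-\lambda)s_2$ implies $s_1=s_2$. A state-morphism on $A$ is a function $m:A\to[0,1]$ with $m(0)=0$ and $m(x\to y)=m(x\rightsquigarrow y)=\min\{1-m(x)+m(y),1\}$ for all $x,y\in A$. The kernel of $s$ is $\mathrm{Ker}(s)=\{a\in A: s(a)=1\}$. Theorem. Let $A$ be a bounded pseudo-BCK algebra and let $s$ be a Bosbach state on $A$. Then the following are equivalent: (a) $s$ is an extremal Bosbach state; (b) $s(x\vee_1 y)=\max\{s(x),s(y)\}$ for all $x,y\in A$; (c) $s(x\vee_2 y)=\max\{s(x),s(y)\}$ for all $x,y\in A$; (d) $s$ is a state-morphism; (e) $\mathrm{Ker}(s)$ is a maximal filter of $A$. In particular, a function $A\to[0,1]$ is an extremal Bosbach state on $A$ if and only if it is a state-morphism on $A$. -/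

import Mathlib

/-- A pseudo-BCK algebra `(A, ≤, →, ⇝, 1)`: `imp x y` is `x → y` and `rimp x y` is `x ⇝ y`. -/
class PseudoBCKAlgebra (A : Type*) extends LE A, One A where
  imp : A → A → A
  rimp : A → A → A
  imp_le : ∀ x y z : A, imp x y ≤ rimp (imp y z) (imp x z)
  rimp_le : ∀ x y z : A, rimp x y ≤ imp (rimp y z) (rimp x z)
  le_imp_rimp : ∀ x y : A, x ≤ rimp (imp x y) y
  le_rimp_imp : ∀ x y : A, x ≤ imp (rimp x y) y
  le_self : ∀ x : A, x ≤ x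
  le_one : ∀ x : A, x ≤ 1
  antisymm : ∀ x y : A, x ≤ y → y ≤ x → x = y
  le_iff_imp : ∀ x y : A, x ≤ y ↔ imp x y = 1
  le_iff_rimp : ∀ x y : A, x ≤ y ↔ rimp x y = 1

/-- A bounded pseudo-BCK algebra: a pseudo-BCK algebra with a least element `0`. -/
class BoundedPseudoBCKAlgebra (A : Type*) extends PseudoBCKAlgebra A, Zero A where
  zero_le : ∀ x : A, 0 ≤ x

namespace PseudoBCKAlgebra

/-- `x ∨₁ y = (x → y) ⇝ y`. -/
def vee₁ {A : Type*} [PseudoBCKAlgebra A] (x y : A) : A := rimp (imp x y) y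

/-- `x ∨₂ y = (x ⇝ y) → y`. -/
def vee₂ {A : Type*} [PseudoBCKAlgebra A] (x y : A) : A := imp (rimp x y) y

/-- Filters (deductive systems). -/
structure IsFilter {A : Type*} [PseudoBCKAlgebra A] (F : Set A) : Prop where
  one_mem : (1 : A) ∈ F
  mem_of_imp_mem : ∀ a b : A, a ∈ F → imp a b ∈ F → b ∈ F

/-- Maximal filters: proper filters not properly contained in another proper filter. -/
structure IsMaximalFilter {A : Type*} [PseudoBCKAlgebra A] (F : Set A) : Prop where
  isFilter : IsFilter F
  ne_univ : F ≠ Set.univ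
  maximal : ∀ G : Set A, IsFilter G → G ≠ Set.univ → ¬ F ⊂ G

/-- Bosbach states, as real-valued functions with values in `[0, 1]`. -/
structure IsBosbachState {A : Type*} [BoundedPseudoBCKAlgebra A] (s : A → ℝ) : Prop where
  mem_Icc : ∀ x : A, s x ∈ Set.Icc (0 : ℝ) 1
  add_imp : ∀ x y : A, s x + s (imp x y) = s y + s (imp y x)
  add_rimp : ∀ x y : A, s x + s (rimp x y) = s y + s (rimp y x)
  map_zero : s 0 = 0
  map_one : s 1 = 1

/-- The Łukasiewicz implication `min {1 - x + y, 1}`. -/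
noncomputable def lukImp (x y : ℝ) : ℝ := min (1 - x + y) 1

/-- State-morphisms, as real-valued functions with values in `[0, 1]`. -/
structure IsStateMorphism {A : Type*} [BoundedPseudoBCKAlgebra A] (m : A → ℝ) : Prop where
  mem_Icc : ∀ x : A, m x ∈ Set.Icc (0 : ℝ) 1
  map_zero : m 0 = 0
  map_imp : ∀ x y : A, m (imp x y) = lukImp (m x) (m y)
  map_rimp : ∀ x y : A, m (rimp x y) = lukImp (m x) (m y)

/-- Extremal Bosbach states. -/
structure IsExtremalBosbachState {A : Type*} [BoundedPseudoBCKAlgebra A] (s : A → ℝ) : Prop where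
  isBosbachState : IsBosbachState s
  extremal : ∀ (t : ℝ) (s₁ s₂ : A → ℝ), 0 < t → t < 1 → IsBosbachState s₁ → IsBosbachState s₂ →
    s = t • s₁ + (1 - t) • s₂ → s₁ = s₂

/-- The kernel `Ker(s) = {a | s a = 1}`. -/
def ker {A : Type*} (s : A → ℝ) : Set A := {a | s a = 1}

end PseudoBCKAlgebra

/-!
Write `j x y = s (x ∨₁ y)`. For a Bosbach state `s` the number `j x y` is the least value of `s` on
an upper bound of `x` and `y` (`vee₁_le`), so it is symmetric in `x, y`, agrees with `s (x ∨₂ y)`,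
and `s (x → y) = s (x ⇝ y) = 1 + s y - j x y`. This makes (b), (c) and (d) equivalent, and it
replaces the passage to the quotient by the kernel.

Condition (b) follows once `s` is *prime*: `j a b = 1` forces `s a = 1` or `s b = 1`. The reason is
a form of prelinearity (`exists_prelinear`): for all `x, y` there are `a, b` with `j a b = 1` such
that `s a = 1` forces `j x y ≤ s y` and `s b = 1` forces `j x y ≤ s x`. A state is prime as soon as
for each `a` with `s a < 1` the values `s (a → (a → ⋯ → 0))` have supremum `1`, because `j a b = 1`
implies `s (a → (a → ⋯ → b)) = s b` (`vee₁_eq_max_of_saturation_zero`). This is obtained in two ways.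

* If `ker s` is maximal, then `{x | s (a → (a → ⋯ → x)) = 1 for some number of arrows}` is a filter
  strictly larger than `ker s`, hence contains `0`.
* If `s` is extremal, put `u x = sup s (a → (a → ⋯ → x))` (`saturation`). The function `u` satisfies
  the Bosbach identities, and `s = (u - u 0) + (s - u + u 0)` splits `s` into two positive multiples
  of Bosbach states. Extremality gives `u = u 0 + (1 - u 0) s`; since `u a = 1`, either `s a = 1` or
  `u 0 = 1`.

Conversely, for a state-morphism `m` and `m a < 1`, the values `m (a → (a → ⋯ → 0))` reach `1` after
finitely many steps, so `ker m` is maximal. If `m` is a proper convex combination of Bosbach states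
`s₁, s₂`, then both inherit (b), so both are state-morphisms, and both have kernel `ker m` by
maximality. State-morphisms with the same kernel are equal (`IsStateMorphism.eq_of_ker_eq`): a
difference between two values could be doubled indefinitely.
-/

namespace PseudoBCKAlgebra

open Filter Topology

/-! ### Exchanging the two implications -/

/-- The pseudo-BCK algebra with the roles of `→` and `⇝` exchanged. -/
abbrev swap {A : Type*} (h : PseudoBCKAlgebra A) : PseudoBCKAlgebra A where
  imp := h.rimp
  rimp := h.imp
  imp_le := h.rimp_le
  rimp_le := h.imp_le
  le_imp_rimp := h.le_rimp_imp
  le_rimp_imp := h.le_imp_rimp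
  le_self := h.le_self
  le_one := h.le_one
  antisymm := h.antisymm
  le_iff_imp := h.le_iff_rimp
  le_iff_rimp := h.le_iff_imp

/-- The bounded pseudo-BCK algebra with the roles of `→` and `⇝` exchanged. -/
abbrev boundedSwap {A : Type*} (h : BoundedPseudoBCKAlgebra A) : BoundedPseudoBCKAlgebra A where
  toPseudoBCKAlgebra := swap h.toPseudoBCKAlgebra
  zero := 0
  zero_le := h.zero_le

/-! ### Arithmetic of pseudo-BCK algebras -/

section Basic

variable {A : Type*} [PseudoBCKAlgebra A] {x y z : A}

theorem eq_one_of_one_le (h : 1 ≤ x) : x = 1 := antisymm x 1 (le_one x) h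

theorem le_trans' (hxy : x ≤ y) (hyz : y ≤ z) : x ≤ z := by
  have h := imp_le x y z
  rw [(le_iff_imp x y).1 hxy, (le_iff_imp y z).1 hyz] at h
  have h' := eq_one_of_one_le h
  exact (le_iff_imp x z).2 (eq_one_of_one_le ((le_iff_rimp _ _).2 h'))

theorem imp_anti (z : A) (hxy : x ≤ y) : imp y z ≤ imp x z := by
  have h := imp_le x y z
  rw [(le_iff_imp x y).1 hxy] at h
  exact (le_iff_rimp _ _).2 (eq_one_of_one_le h)

theorem rimp_anti {A : Type*} [h : PseudoBCKAlgebra A] {x y : A} (z : A) (hxy : x ≤ y) :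
    rimp y z ≤ rimp x z :=
  @imp_anti A (swap h) _ _ z hxy

theorem imp_rimp_le (x y z : A) : imp x (rimp y z) ≤ rimp y (imp x z) :=
  le_trans' (imp_le x (rimp y z) z) (rimp_anti _ (le_rimp_imp y z))

theorem rimp_imp_le {A : Type*} [h : PseudoBCKAlgebra A] (x y z : A) :
    rimp x (imp y z) ≤ imp y (rimp x z) :=
  @imp_rimp_le A (swap h) x y z

theorem imp_rimp_comm (x y z : A) : imp x (rimp y z) = rimp y (imp x z) :=
  antisymm _ _ (imp_rimp_le x y z) (rimp_imp_le y x z)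

theorem le_rimp_iff : x ≤ rimp y z ↔ y ≤ imp x z := by
  rw [le_iff_imp, le_iff_rimp y, imp_rimp_comm]

theorem imp_le_imp_imp (x y z : A) : imp y z ≤ imp (imp x y) (imp x z) :=
  le_rimp_iff.1 (imp_le x y z)

theorem imp_mono (z : A) (hxy : x ≤ y) : imp z x ≤ imp z y := by
  have h := imp_le_imp_imp z x y
  rw [(le_iff_imp x y).1 hxy] at h
  exact (le_iff_imp _ _).2 (eq_one_of_one_le h)

theorem one_imp (x : A) : imp 1 x = x := by
  have h := le_rimp_imp x x
  rw [(le_iff_rimp x x).1 (le_self x)] at h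
  exact antisymm _ _ ((le_iff_rimp _ _).2 (eq_one_of_one_le (le_imp_rimp 1 x))) h

theorem one_rimp {A : Type*} [h : PseudoBCKAlgebra A] (x : A) : rimp 1 x = x :=
  @one_imp A (swap h) x

theorem le_imp (x y : A) : x ≤ imp y x := by
  have h := imp_anti x (le_one y)
  rwa [one_imp] at h

theorem le_rimp {A : Type*} [h : PseudoBCKAlgebra A] (x y : A) : x ≤ rimp y x :=
  @le_imp A (swap h) x y

theorem le_vee₁_left (x y : A) : x ≤ vee₁ x y := le_imp_rimp x y

theorem le_vee₁_right (x y : A) : y ≤ vee₁ x y := le_rimp y _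

theorem vee₁_imp (x y : A) : imp (vee₁ x y) y = imp x y :=
  antisymm _ _ (imp_anti y (le_vee₁_left x y)) (le_rimp_imp (imp x y) y)

theorem vee₁_eq_of_le (h : x ≤ y) : vee₁ x y = y := by
  rw [vee₁, (le_iff_imp x y).1 h, one_rimp]

theorem le_imp_iterate (a x : A) (n : ℕ) : x ≤ (imp a)^[n] x := by
  induction n with
  | zero => exact le_self x
  | succ n ih => rw [Function.iterate_succ_apply']; exact le_trans' ih (le_imp _ a)

theorem imp_iterate_mono (a : A) (n : ℕ) (h : x ≤ y) : (imp a)^[n] x ≤ (imp a)^[n] y := by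
  induction n with
  | zero => exact h
  | succ n ih => simp only [Function.iterate_succ_apply']; exact imp_mono a ih

theorem imp_iterate_rimp (a x y : A) (n : ℕ) :
    (imp a)^[n] (rimp x y) = rimp x ((imp a)^[n] y) := by
  induction n with
  | zero => rfl
  | succ n ih => simp only [Function.iterate_succ_apply', ih, imp_rimp_comm]

theorem imp_iterate_monotone_index (a x : A) {m n : ℕ} (h : m ≤ n) :
    (imp a)^[m] x ≤ (imp a)^[n] x := by
  obtain ⟨k, rfl⟩ := Nat.exists_eq_add_of_le' h
  rw [Function.iterate_add_apply]
  exact le_imp_iterate a _ k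

theorem imp_le_imp_iterate (a x y : A) (n : ℕ) :
    imp x y ≤ imp ((imp a)^[n] x) ((imp a)^[n] y) := by
  induction n with
  | zero => exact le_self _
  | succ n ih =>
    simp only [Function.iterate_succ_apply']
    exact le_trans' ih (imp_le_imp_imp a _ _)

end Basic

/-! ### Bosbach states -/

namespace IsBosbachState

variable {A : Type*} [BoundedPseudoBCKAlgebra A] {s : A → ℝ}

theorem swap {A : Type*} [h : BoundedPseudoBCKAlgebra A] {s : A → ℝ} (hs : IsBosbachState s) :
    @IsBosbachState A (boundedSwap h) s :=
  @IsBosbachState.mk A (boundedSwap h) s hs.mem_Icc hs.add_rimp hs.add_imp hs.map_zero hs.map_one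

theorem le_one (hs : IsBosbachState s) (x : A) : s x ≤ 1 := (hs.mem_Icc x).2

theorem imp_of_le (hs : IsBosbachState s) {x y : A} (h : x ≤ y) :
    s (imp y x) = 1 - s y + s x := by
  have h1 := hs.add_imp x y
  rw [(le_iff_imp x y).1 h, hs.map_one] at h1
  linarith

theorem mono (hs : IsBosbachState s) {x y : A} (h : x ≤ y) : s x ≤ s y := by
  linarith [hs.imp_of_le h, hs.le_one (imp y x)]

theorem map_imp (hs : IsBosbachState s) (x y : A) :
    s (imp x y) = 1 + s y - s (vee₁ x y) := by
  rw [← vee₁_imp, hs.imp_of_le (le_vee₁_right x y)]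
  ring

theorem vee₁_comm (hs : IsBosbachState s) (x y : A) : s (vee₁ x y) = s (vee₁ y x) := by
  linarith [hs.add_imp x y, hs.map_imp x y, hs.map_imp y x]

/-- The value `s (x ∨₁ y)` is a lower bound for `s` on the common upper bounds of `x` and `y`. -/
theorem vee₁_le (hs : IsBosbachState s) {x y z : A} (hx : x ≤ z) (hy : y ≤ z) :
    s (vee₁ x y) ≤ s z := by
  rw [hs.vee₁_comm, ← vee₁_eq_of_le hx, hs.vee₁_comm x z]
  exact hs.mono (rimp_anti x (imp_anti x hy))

theorem vee₁_eq_of_ge (hs : IsBosbachState s) {x y : A} (h : y ≤ x) : s (vee₁ x y) = s x := by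
  rw [hs.vee₁_comm, vee₁_eq_of_le h]

theorem vee₁_mono (hs : IsBosbachState s) {x y x' y' : A} (hx : x ≤ x') (hy : y ≤ y') :
    s (vee₁ x y) ≤ s (vee₁ x' y') :=
  hs.vee₁_le (le_trans' hx (le_vee₁_left _ _)) (le_trans' hy (le_vee₁_right _ _))

theorem le_vee₁_left (hs : IsBosbachState s) (x y : A) : s x ≤ s (vee₁ x y) :=
  hs.mono (PseudoBCKAlgebra.le_vee₁_left x y)

theorem le_vee₁_right (hs : IsBosbachState s) (x y : A) : s y ≤ s (vee₁ x y) :=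
  hs.mono (PseudoBCKAlgebra.le_vee₁_right x y)

theorem vee₁_eq_vee₂ {A : Type*} [h : BoundedPseudoBCKAlgebra A] {s : A → ℝ}
    (hs : IsBosbachState s) (x y : A) : s (vee₁ x y) = s (vee₂ x y) :=
  le_antisymm (hs.vee₁_le (le_rimp_imp x y) (le_imp y _))
    (@vee₁_le A (boundedSwap h) s hs.swap x y _ (le_imp_rimp x y) (le_rimp y _))

theorem map_rimp {A : Type*} [h : BoundedPseudoBCKAlgebra A] {s : A → ℝ}
    (hs : IsBosbachState s) (x y : A) : s (rimp x y) = s (imp x y) := by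
  have h1 : s (rimp x y) = 1 + s y - s (vee₂ x y) := @map_imp A (boundedSwap h) s hs.swap x y
  rw [h1, hs.map_imp, hs.vee₁_eq_vee₂]

/-- Iterating `a → ·` and `a ⇝ ·` gives the same values, although not the same elements. -/
theorem map_imp_iterate (hs : IsBosbachState s) (a x : A) (n : ℕ) :
    s ((imp a)^[n] x) = s ((rimp a)^[n] x) := by
  induction n generalizing x with
  | zero => rfl
  | succ n ih =>
    rw [Function.iterate_succ_apply', ← hs.map_rimp, ← imp_iterate_rimp, ih,
      ← Function.iterate_succ_apply]

theorem isFilter_ker (hs : IsBosbachState s) : IsFilter (ker s) where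
  one_mem := hs.map_one
  mem_of_imp_mem a b ha hab := by
    change s b = 1
    have ha' : s a = 1 := ha
    have hab' : s (imp a b) = 1 := hab
    linarith [hs.add_imp a b, hs.le_one b, hs.le_one (imp b a)]

theorem ker_ne_univ (hs : IsBosbachState s) : ker s ≠ Set.univ := by
  intro h
  have h0 : (0 : A) ∈ ker s := h ▸ Set.mem_univ _
  exact zero_ne_one (hs.map_zero.symm.trans h0)

/-! ### Prelinearity and primeness -/

/-- Prelinearity of the quotient by the kernel, in terms of `s` alone. -/
theorem exists_prelinear (hs : IsBosbachState s) (x y : A) :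
    ∃ a b : A, s (vee₁ a b) = 1 ∧ s a ≤ 1 - s (vee₁ x y) + s y ∧
      s b ≤ 1 - s (vee₁ x y) + s x := by
  -- `a` and `b` are the contrapositive forms of `g → y` and `g → x`.
  set g := vee₁ x y with hg
  have hgx : x ≤ g := PseudoBCKAlgebra.le_vee₁_left x y
  have hgy : y ≤ g := PseudoBCKAlgebra.le_vee₁_right x y
  have hzero (z : A) : s (rimp (imp z 0) 0) = s z :=
    hs.vee₁_eq_of_ge (BoundedPseudoBCKAlgebra.zero_le z)
  have contra (u v : A) : s (rimp (imp u 0) (imp v 0)) ≤ 1 - s (vee₁ v u) + s u := by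
    rw [← imp_rimp_comm, hs.map_imp, hzero]
    linarith [hs.vee₁_mono (le_self v) (le_imp_rimp u 0)]
  have hvg (z : A) (hz : z ≤ g) : s (vee₁ g z) = s g := hs.vee₁_eq_of_ge hz
  refine ⟨rimp (imp y 0) (imp g 0), rimp (imp x 0) (imp g 0), ?_, ?_, ?_⟩
  · set a := rimp (imp y 0) (imp g 0) with ha
    set b := rimp (imp x 0) (imp g 0) with hb
    have h1 : imp a b = rimp (imp x 0) (vee₂ (imp y 0) (imp g 0)) := by
      rw [hb, imp_rimp_comm, ha, vee₂]
    have h2 : s (vee₂ (imp y 0) (imp g 0)) = s (imp y 0) := by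
      rw [← hs.vee₁_eq_vee₂, hs.vee₁_eq_of_ge (imp_anti 0 hgy)]
    have h3 : s (imp a b) ≤ s (rimp (imp x 0) (imp y 0)) := by
      have h4 : imp y 0 ≤ vee₂ (imp y 0) (imp g 0) := le_rimp_imp _ _
      rw [h1, hs.map_rimp, hs.map_rimp]
      linarith [hs.vee₁_mono (le_self (imp x 0)) h4, hs.map_imp (imp x 0) (imp y 0),
        hs.map_imp (imp x 0) (vee₂ (imp y 0) (imp g 0))]
    have h4 := contra x y
    have h5 : s (imp g x) ≤ s b := hs.mono (imp_le g x 0)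
    rw [hs.vee₁_comm y x, ← hg] at h4
    linarith [hs.map_imp a b, hs.map_imp g x, hvg x hgx, hs.le_one (vee₁ a b)]
  · have := contra y g
    rwa [hvg y hgy] at this
  · have := contra x g
    rwa [hvg x hgx] at this

theorem vee₁_eq_max_of_prime (hs : IsBosbachState s)
    (hp : ∀ a b : A, s (vee₁ a b) = 1 → s a = 1 ∨ s b = 1) (x y : A) :
    s (vee₁ x y) = max (s x) (s y) := by
  obtain ⟨a, b, hab, ha, hb⟩ := hs.exists_prelinear x y
  refine le_antisymm (le_max_iff.2 ?_) (max_le (hs.le_vee₁_left x y) (hs.le_vee₁_right x y))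
  rcases hp a b hab with h | h
  · right; linarith
  · left; linarith

/-- If `a` and `b` have join `1` modulo the kernel, prefixing arrows from `a` does not change the
value at `b`. -/
theorem map_imp_iterate_of_vee₁_eq_one (hs : IsBosbachState s) {a b : A}
    (h : s (vee₁ a b) = 1) (n : ℕ) : s ((imp a)^[n] b) = s b := by
  induction n with
  | zero => rfl
  | succ n ih =>
    rw [Function.iterate_succ_apply', hs.map_imp, ih]
    linarith [hs.vee₁_mono (le_self a) (le_imp_iterate a b n),
      hs.le_one (vee₁ a ((imp a)^[n] b))]

/-! ### Saturation of a state along an element -/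

end IsBosbachState

/-- The supremum, equivalently the limit, of `s (a → (a → ⋯ → x))` over the number of arrows.
On an MV-algebra this is the limit of `s (aⁿ → x)`. -/
noncomputable def saturation {A : Type*} [PseudoBCKAlgebra A] (s : A → ℝ) (a x : A) : ℝ :=
  ⨆ n : ℕ, s ((imp a)^[n] x)

namespace IsBosbachState

variable {A : Type*} [BoundedPseudoBCKAlgebra A] {s : A → ℝ}

theorem bddAbove_range (hs : IsBosbachState s) {ι : Type*} (f : ι → A) :
    BddAbove (Set.range fun i => s (f i)) :=
  ⟨1, by rintro _ ⟨i, rfl⟩; exact hs.le_one _⟩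

theorem tendsto_saturation (hs : IsBosbachState s) (a x : A) :
    Tendsto (fun n : ℕ => s ((imp a)^[n] x)) atTop (𝓝 (saturation s a x)) :=
  tendsto_atTop_ciSup (fun _ _ h => hs.mono (imp_iterate_monotone_index a x h))
    (hs.bddAbove_range _)

theorem saturation_swap {A : Type*} [h : BoundedPseudoBCKAlgebra A] {s : A → ℝ}
    (hs : IsBosbachState s) (a x : A) :
    @saturation A (boundedSwap h).toPseudoBCKAlgebra s a x = saturation s a x :=
  iSup_congr fun n => (hs.map_imp_iterate a x n).symm

theorem le_saturation (hs : IsBosbachState s) (a x : A) : s x ≤ saturation s a x :=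
  le_ciSup (hs.bddAbove_range fun n : ℕ => (imp a)^[n] x) 0

theorem saturation_le_one (hs : IsBosbachState s) (a x : A) : saturation s a x ≤ 1 :=
  ciSup_le fun _ => hs.le_one _

theorem saturation_mono (hs : IsBosbachState s) (a : A) {x y : A} (h : x ≤ y) :
    saturation s a x ≤ saturation s a y :=
  ciSup_mono (hs.bddAbove_range _) fun n => hs.mono (imp_iterate_mono a n h)

theorem saturation_self (hs : IsBosbachState s) (a : A) : saturation s a a = 1 := by
  refine le_antisymm (hs.saturation_le_one a a) ?_
  have h := le_ciSup (hs.bddAbove_range fun n : ℕ => (imp a)^[n] a) 1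
  simp only [Function.iterate_one, (le_iff_imp a a).1 (le_self a), hs.map_one] at h
  exact h

theorem saturation_one (hs : IsBosbachState s) (a : A) : saturation s a 1 = 1 :=
  le_antisymm (hs.saturation_le_one a 1) (hs.map_one ▸ hs.le_saturation a 1)

theorem imp_iterate_sub_anti (hs : IsBosbachState s) (a : A) {x y : A} (h : x ≤ y) (n : ℕ) :
    s ((imp a)^[n] y) - s y ≤ s ((imp a)^[n] x) - s x := by
  induction n with
  | zero => simp
  | succ n ih =>
    simp only [Function.iterate_succ_apply', hs.map_imp]
    linarith [hs.vee₁_mono (le_self a) (imp_iterate_mono a n h)]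

/-- Saturation increases the value at `x` by at most its increase at `0`. -/
theorem saturation_le_add (hs : IsBosbachState s) (a x : A) :
    saturation s a x ≤ s x + saturation s a 0 := by
  refine ciSup_le fun n => ?_
  have h1 := hs.imp_iterate_sub_anti a (BoundedPseudoBCKAlgebra.zero_le x) n
  have h2 : s ((imp a)^[n] 0) ≤ saturation s a 0 :=
    le_ciSup (hs.bddAbove_range fun n : ℕ => (imp a)^[n] (0 : A)) n
  linarith [hs.map_zero]

theorem map_imp_iterate_rimp (hs : IsBosbachState s) (a x y : A) (n : ℕ) :
    s ((imp a)^[n] (rimp x y)) = s (imp x ((imp a)^[n] y)) := by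
  rw [imp_iterate_rimp, hs.map_rimp]

theorem map_imp_iterate_rimp_le (hs : IsBosbachState s) (a x y : A) (m n : ℕ) :
    s ((imp a)^[m] (rimp x y)) ≤ s (imp ((imp a)^[n] x) ((imp a)^[n + m] y)) := by
  rw [hs.map_imp_iterate_rimp, Function.iterate_add_apply]
  exact hs.mono (imp_le_imp_iterate a x _ n)

/-- The sequence on the left is symmetric in `x` and `y`; this is what gives the saturation the
Bosbach identities. It holds because `s (a → ⋯ → (x ⇝ y))` is `s (x → (a → ⋯ → y))`, and replacing
`x` by its own iterate is compensated by doubling the number of arrows in front of `y`. -/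
theorem tendsto_vee₁_iterate (hs : IsBosbachState s) (a x y : A) :
    Tendsto (fun n : ℕ => s (vee₁ ((imp a)^[n] x) ((imp a)^[n] y))) atTop
      (𝓝 (1 + saturation s a y - saturation s a (rimp x y))) := by
  have hdouble : Tendsto (fun n : ℕ => n + n) atTop atTop :=
    tendsto_atTop_mono (fun n => Nat.le_add_left n n) tendsto_id
  have hy := (hs.tendsto_saturation a y).comp hdouble
  have hr := hs.tendsto_saturation a (rimp x y)
  have hq : Tendsto (fun n : ℕ => s (imp ((imp a)^[n] x) ((imp a)^[n + n] y))) atTop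
      (𝓝 (saturation s a (rimp x y))) := by
    refine tendsto_of_tendsto_of_tendsto_of_le_of_le hr (hr.comp hdouble)
      (fun n => hs.map_imp_iterate_rimp_le a x y n n) fun n => ?_
    simp only [Function.comp_apply]
    rw [hs.map_imp_iterate_rimp]
    exact hs.mono (imp_anti _ (le_imp_iterate a x n))
  have hv : Tendsto (fun n : ℕ => s (vee₁ ((imp a)^[n] x) ((imp a)^[n + n] y))) atTop
      (𝓝 (1 + saturation s a y - saturation s a (rimp x y))) := by
    refine ((hy.const_add 1).sub hq).congr fun n => ?_
    simp only [Function.comp_apply]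
    rw [hs.map_imp]
    ring
  have hJ := tendsto_atTop_ciSup
    (f := fun n : ℕ => s (vee₁ ((imp a)^[n] x) ((imp a)^[n] y)))
    (fun m n h => hs.vee₁_mono (imp_iterate_monotone_index a x h)
      (imp_iterate_monotone_index a y h)) (hs.bddAbove_range _)
  have hv' := tendsto_of_tendsto_of_tendsto_of_le_of_le hJ (hJ.comp hdouble)
    (fun n => hs.vee₁_mono (le_self ((imp a)^[n] x))
      (imp_iterate_monotone_index a y (Nat.le_add_left n n)))
    (fun n => hs.vee₁_mono (imp_iterate_monotone_index a x (Nat.le_add_left n n))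
      (le_self ((imp a)^[n + n] y)))
  rwa [tendsto_nhds_unique hv' hv] at hJ

theorem saturation_add_rimp (hs : IsBosbachState s) (a x y : A) :
    saturation s a x + saturation s a (rimp x y) =
      saturation s a y + saturation s a (rimp y x) := by
  have h := tendsto_nhds_unique (hs.tendsto_vee₁_iterate a x y)
    ((hs.tendsto_vee₁_iterate a y x).congr fun n => hs.vee₁_comm _ _)
  linarith

theorem saturation_add_imp {A : Type*} [h : BoundedPseudoBCKAlgebra A] {s : A → ℝ}
    (hs : IsBosbachState s) (a x y : A) :
    saturation s a x + saturation s a (imp x y) =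
      saturation s a y + saturation s a (imp y x) := by
  have h1 := @saturation_add_rimp A (boundedSwap h) s hs.swap a x y
  simp only [hs.saturation_swap] at h1
  exact h1

theorem vee₁_eq_max_of_saturation_zero (hs : IsBosbachState s)
    (h : ∀ a : A, s a = 1 ∨ saturation s a 0 = 1) (x y : A) :
    s (vee₁ x y) = max (s x) (s y) := by
  refine hs.vee₁_eq_max_of_prime (fun a b hab => (h a).imp_right fun h0 => ?_) x y
  have h1 : saturation s a b = s b := by
    simp only [saturation, hs.map_imp_iterate_of_vee₁_eq_one hab, ciSup_const]
  exact le_antisymm (hs.le_one b)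
    (h1 ▸ h0 ▸ hs.saturation_mono a (BoundedPseudoBCKAlgebra.zero_le b))

end IsBosbachState

/-! ### Extremal states -/

/-- Extremality applied to the splitting `s = (u - u 0) + (s - u + u 0)` with `u` the saturation. -/
theorem IsExtremalBosbachState.saturation_eq {A : Type*} [BoundedPseudoBCKAlgebra A] {s : A → ℝ}
    (h : IsExtremalBosbachState s) (a x : A) :
    saturation s a x = saturation s a 0 + (1 - saturation s a 0) * s x := by
  have hs := h.isBosbachState
  set c := saturation s a 0 with hc
  have hzero (y : A) : c ≤ saturation s a y :=
    hs.saturation_mono a (BoundedPseudoBCKAlgebra.zero_le y)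
  have hle (y : A) := hs.le_saturation a y
  have hadd (y : A) := hs.saturation_le_add a y
  have hone (y : A) := hs.saturation_le_one a y
  have hc0 : 0 ≤ c := hs.map_zero ▸ hle 0
  rcases hc0.eq_or_lt with hc0 | hc0
  · have h1 := hadd x
    rw [← hc, ← hc0] at h1
    rw [← hc0]
    linarith [hle x]
  rcases (hone 0).eq_or_lt with hc1 | hc1
  · rw [← hc] at hc1
    rw [hc1]
    linarith [hzero x, hone x]
  rw [← hc] at hc1
  have hc1' : 0 < 1 - c := by linarith
  have h1 : IsBosbachState fun y => (saturation s a y - c) / (1 - c) :=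
    { mem_Icc := fun y => ⟨div_nonneg (by linarith [hzero y]) hc1'.le,
        (div_le_one hc1').2 (by linarith [hone y])⟩
      add_imp := fun y z => by
        rw [← add_div, ← add_div]; congr 1; linarith [hs.saturation_add_imp a y z]
      add_rimp := fun y z => by
        rw [← add_div, ← add_div]; congr 1; linarith [hs.saturation_add_rimp a y z]
      map_zero := by rw [← hc, sub_self, zero_div]
      map_one := by rw [hs.saturation_one, div_self hc1'.ne'] }
  have h2 : IsBosbachState fun y => (s y - saturation s a y + c) / c :=
    { mem_Icc := fun y => ⟨div_nonneg (by linarith [hadd y]) hc0.le,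
        (div_le_one hc0).2 (by linarith [hle y])⟩
      add_imp := fun y z => by
        rw [← add_div, ← add_div]; congr 1
        linarith [hs.saturation_add_imp a y z, hs.add_imp y z]
      add_rimp := fun y z => by
        rw [← add_div, ← add_div]; congr 1
        linarith [hs.saturation_add_rimp a y z, hs.add_rimp y z]
      map_zero := by rw [← hc, hs.map_zero]; simp
      map_one := by rw [hs.saturation_one, hs.map_one, sub_self, zero_add, div_self hc0.ne'] }
  have heq := congrFun (h.extremal (1 - c) _ _ hc1' (by linarith) h1 h2 (by
    funext y
    simp only [Pi.add_apply, Pi.smul_apply, smul_eq_mul, sub_sub_cancel]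
    rw [mul_div_cancel₀ _ hc1'.ne', mul_div_cancel₀ _ hc0.ne']
    ring)) x
  rw [div_eq_div_iff hc1'.ne' hc0.ne'] at heq
  linarith

theorem IsExtremalBosbachState.vee₁_eq_max {A : Type*} [BoundedPseudoBCKAlgebra A] {s : A → ℝ}
    (h : IsExtremalBosbachState s) (x y : A) : s (vee₁ x y) = max (s x) (s y) := by
  have hs := h.isBosbachState
  refine hs.vee₁_eq_max_of_saturation_zero (fun a => ?_) x y
  have h1 := h.saturation_eq a a
  rw [hs.saturation_self] at h1
  have h2 : (1 - s a) * (1 - saturation s a 0) = 0 := by linarith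
  exact (mul_eq_zero.1 h2).imp (fun h => by linarith) fun h => by linarith

/-! ### Maximal kernels -/

/-- For `s a < 1` this filter strictly contains the kernel of `s`. -/
theorem IsBosbachState.isFilter_imp_iterate {A : Type*} [h : BoundedPseudoBCKAlgebra A]
    {s : A → ℝ} (hs : IsBosbachState s) (a : A) :
    IsFilter {x : A | ∃ n : ℕ, s ((imp a)^[n] x) = 1} where
  one_mem := ⟨0, hs.map_one⟩
  mem_of_imp_mem := by
    rintro x y ⟨n, hn⟩ ⟨m, hm⟩
    refine ⟨n + m, ?_⟩
    -- With `⇝`-iterates, `a` can be exchanged with the antecedent of `x → y`.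
    rw [hs.map_imp_iterate] at hn hm ⊢
    have h1 : s ((rimp a)^[m] (imp x y)) ≤ s (rimp ((rimp a)^[n] x) ((rimp a)^[n + m] y)) :=
      @map_imp_iterate_rimp_le A (boundedSwap h) s hs.swap a x y m n
    have h2 := le_antisymm (hs.le_one _) (hm ▸ h1)
    exact @IsFilter.mem_of_imp_mem A (PseudoBCKAlgebra.swap h.toPseudoBCKAlgebra) _
      (@isFilter_ker A (boundedSwap h) s hs.swap) _ _ hn h2

theorem IsBosbachState.vee₁_eq_max_of_isMaximalFilter_ker {A : Type*} [BoundedPseudoBCKAlgebra A]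
    {s : A → ℝ} (hs : IsBosbachState s) (hk : IsMaximalFilter (ker s)) (x y : A) :
    s (vee₁ x y) = max (s x) (s y) := by
  refine hs.vee₁_eq_max_of_saturation_zero (fun a => or_iff_not_imp_left.2 fun ha => ?_) x y
  have huniv : {x : A | ∃ n : ℕ, s ((imp a)^[n] x) = 1} = Set.univ := by
    by_contra hne
    have hsub : ker s ⊆ {x : A | ∃ n : ℕ, s ((imp a)^[n] x) = 1} := fun z hz => ⟨0, hz⟩
    refine hk.maximal _ (hs.isFilter_imp_iterate a) hne
      ((Set.ssubset_iff_of_subset hsub).2 ⟨a, ⟨1, ?_⟩, ha⟩)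
    rw [Function.iterate_one, (le_iff_imp a a).1 (le_self a), hs.map_one]
  obtain ⟨n, hn⟩ : (0 : A) ∈ {x : A | ∃ n : ℕ, s ((imp a)^[n] x) = 1} := huniv ▸ Set.mem_univ _
  exact le_antisymm (hs.saturation_le_one a 0)
    (hn ▸ le_ciSup (hs.bddAbove_range fun n : ℕ => (imp a)^[n] (0 : A)) n)

/-! ### State-morphisms -/

theorem IsBosbachState.isStateMorphism_of_vee₁_eq_max {A : Type*} [BoundedPseudoBCKAlgebra A]
    {s : A → ℝ} (hs : IsBosbachState s) (h : ∀ x y : A, s (vee₁ x y) = max (s x) (s y)) :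
    IsStateMorphism s := by
  have key (x y : A) : s (imp x y) = lukImp (s x) (s y) := by
    rw [hs.map_imp, h, lukImp]
    rcases le_total (s x) (s y) with hxy | hxy
    · rw [max_eq_right hxy, min_eq_right (by linarith)]; ring
    · rw [max_eq_left hxy, min_eq_left (by linarith)]; ring
  exact ⟨hs.mem_Icc, hs.map_zero, key, fun x y => (hs.map_rimp x y).trans (key x y)⟩

namespace IsStateMorphism

variable {A : Type*} [BoundedPseudoBCKAlgebra A] {m : A → ℝ}

theorem isBosbachState (hm : IsStateMorphism m) : IsBosbachState m := by
  have key (u v : ℝ) : u + lukImp u v = v + lukImp v u := by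
    simp only [lukImp]
    rcases le_total u v with h | h
    · rw [min_eq_right (by linarith), min_eq_left (by linarith)]; ring
    · rw [min_eq_left (by linarith), min_eq_right (by linarith)]; ring
  refine ⟨hm.mem_Icc, fun x y => ?_, fun x y => ?_, hm.map_zero, ?_⟩
  · rw [hm.map_imp, hm.map_imp, key]
  · rw [hm.map_rimp, hm.map_rimp, key]
  · rw [← (le_iff_imp (0 : A) 0).1 (le_self 0), hm.map_imp, hm.map_zero]
    norm_num [lukImp]

theorem vee₁_eq_max (hm : IsStateMorphism m) (x y : A) :
    m (vee₁ x y) = max (m x) (m y) := by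
  have h := hm.isBosbachState.map_imp x y
  rw [hm.map_imp, lukImp] at h
  rcases le_total (m x) (m y) with hxy | hxy
  · rw [min_eq_right (by linarith)] at h
    rw [max_eq_right hxy]; linarith
  · rw [min_eq_left (by linarith)] at h
    rw [max_eq_left hxy]; linarith

theorem map_imp_iterate_zero (hm : IsStateMorphism m) (a : A) (n : ℕ) :
    m ((imp a)^[n] 0) = min (n * (1 - m a)) 1 := by
  induction n with
  | zero => simp [hm.map_zero]
  | succ n ih =>
    have ha := (hm.mem_Icc a).2
    rw [Function.iterate_succ_apply', hm.map_imp, ih, lukImp]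
    push_cast
    rcases le_total ((n : ℝ) * (1 - m a)) 1 with h | h
    · rw [min_eq_left h]; congr 1; ring
    · rw [min_eq_right h, min_eq_right (by linarith), min_eq_right (by linarith)]

theorem isMaximalFilter_ker (hm : IsStateMorphism m) : IsMaximalFilter (ker m) where
  isFilter := hm.isBosbachState.isFilter_ker
  ne_univ := hm.isBosbachState.ker_ne_univ
  maximal := by
    intro G hG hne hlt
    obtain ⟨a, haG, ha⟩ := Set.exists_of_ssubset hlt
    have hlt1 : m a < 1 := lt_of_le_of_ne (hm.mem_Icc a).2 ha
    obtain ⟨n, hn⟩ := exists_nat_ge (1 / (1 - m a))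
    have hn' : 1 ≤ (n : ℝ) * (1 - m a) := (div_le_iff₀ (by linarith)).1 hn
    have hmem : (imp a)^[n] (0 : A) ∈ G :=
      hlt.subset ((hm.map_imp_iterate_zero a n).trans (min_eq_right hn'))
    have hdesc (k : ℕ) : (imp a)^[k] (0 : A) ∈ G → (0 : A) ∈ G := by
      induction k with
      | zero => exact id
      | succ k ih =>
        intro hk
        rw [Function.iterate_succ_apply'] at hk
        exact ih (hG.mem_of_imp_mem _ _ haG hk)
    refine hne (Set.eq_univ_of_forall fun x => hG.mem_of_imp_mem 0 x (hdesc n hmem) ?_)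
    rw [(le_iff_imp 0 x).1 (BoundedPseudoBCKAlgebra.zero_le x)]
    exact hG.one_mem

theorem map_double (hm : IsStateMorphism m) (x : A) :
    m (imp (imp x 0) x) = min (2 * m x) 1 := by
  have h := hm.mem_Icc x
  simp only [hm.map_imp, lukImp, hm.map_zero]
  rw [min_eq_left (a := 1 - m x + 0) (by linarith [h.1])]
  congr 1; ring

theorem map_coDouble (hm : IsStateMorphism m) (x : A) :
    m (imp (imp x (imp x 0)) 0) = max (2 * m x - 1) 0 := by
  have h := hm.mem_Icc x
  simp only [hm.map_imp, lukImp, hm.map_zero]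
  rw [min_eq_left (a := 1 - m x + 0) (by linarith [h.1])]
  rcases le_total (2 * m x) 1 with h' | h'
  · rw [min_eq_right (a := 1 - m x + (1 - m x + 0)) (by linarith), max_eq_right (by linarith)]
    norm_num
  · rw [min_eq_left (a := 1 - m x + (1 - m x + 0)) (by linarith), max_eq_left (by linarith),
      min_eq_left (by linarith [h.2])]
    ring

/-- A difference `m₁ x - m₂ x` is doubled by `¬x → x` or by `¬(x → ¬x)`, unless `1/2` separates the
two values, in which case `¬x → x` lies in only one of the kernels. -/
theorem eq_of_ker_eq {m₁ m₂ : A → ℝ} (h₁ : IsStateMorphism m₁) (h₂ : IsStateMorphism m₂)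
    (hk : ker m₁ = ker m₂) : m₁ = m₂ := by
  have hk' (x : A) : m₁ x = 1 ↔ m₂ x = 1 := Set.ext_iff.1 hk x
  have bound (n : ℕ) : ∀ x : A, 2 ^ n * |m₁ x - m₂ x| ≤ 1 := by
    induction n with
    | zero =>
      intro x
      have a1 := h₁.mem_Icc x
      have a2 := h₂.mem_Icc x
      rw [pow_zero, one_mul, abs_le]
      constructor <;> linarith [a1.1, a1.2, a2.1, a2.2]
    | succ n ih =>
      intro x
      suffices ∃ y : A, m₁ y - m₂ y = 2 * (m₁ x - m₂ x) by
        obtain ⟨y, hy⟩ := this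
        have h := ih y
        rw [hy, abs_mul, abs_two] at h
        rw [pow_succ]
        linarith
      have hd := hk' (imp (imp x 0) x)
      rw [h₁.map_double, h₂.map_double] at hd
      by_cases c1 : 2 * m₁ x < 1
      · have c2 : 2 * m₂ x < 1 := by
          by_contra c2
          have := hd.2 (min_eq_right (not_lt.1 c2))
          rw [min_eq_left c1.le] at this
          linarith
        refine ⟨imp (imp x 0) x, ?_⟩
        rw [h₁.map_double, h₂.map_double, min_eq_left c1.le, min_eq_left c2.le]
        ring
      · have c2 : 1 ≤ 2 * m₂ x := by
          by_contra c2
          have := hd.1 (min_eq_right (not_lt.1 c1))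
          rw [min_eq_left (not_le.1 c2).le] at this
          linarith
        refine ⟨imp (imp x (imp x 0)) 0, ?_⟩
        rw [h₁.map_coDouble, h₂.map_coDouble, max_eq_left (by linarith),
          max_eq_left (by linarith)]
        ring
  funext x
  by_contra hne
  have hpos : 0 < |m₁ x - m₂ x| := abs_pos.2 (sub_ne_zero.2 hne)
  obtain ⟨n, hn⟩ := pow_unbounded_of_one_lt (1 / |m₁ x - m₂ x|) (one_lt_two (α := ℝ))
  have h := (div_lt_iff₀ hpos).1 hn
  linarith [bound n x]

/-- If a state-morphism is a proper convex combination of two Bosbach states, it equals the first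
of them. -/
theorem eq_of_convexCombination (hm : IsStateMorphism m) {t : ℝ} {s₁ s₂ : A → ℝ} (ht : 0 < t)
    (ht' : t < 1) (hs₁ : IsBosbachState s₁) (hs₂ : IsBosbachState s₂)
    (h : m = t • s₁ + (1 - t) • s₂) : m = s₁ := by
  have hx (x : A) : m x = t * s₁ x + (1 - t) * s₂ x := by rw [h]; simp
  -- Each of the two nonnegative gaps vanishes because their weighted sum does.
  have gap {x y : A} (hxy : m (vee₁ x y) = m x) : s₁ (vee₁ x y) = s₁ x := by
    have g1 := hs₁.le_vee₁_left x y
    have g2 := mul_nonneg (sub_nonneg.2 ht'.le) (sub_nonneg.2 (hs₂.le_vee₁_left x y))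
    rw [hx, hx] at hxy
    refine le_antisymm (le_of_mul_le_mul_left ?_ ht) g1
    linarith
  have hmax (x y : A) : s₁ (vee₁ x y) = max (s₁ x) (s₁ y) := by
    refine le_antisymm (le_max_iff.2 ?_) (max_le (hs₁.le_vee₁_left x y) (hs₁.le_vee₁_right x y))
    rcases le_total (m x) (m y) with hle | hle
    · right
      rw [hs₁.vee₁_comm]
      exact (gap (by rw [hm.vee₁_eq_max, max_eq_left hle])).le
    · left
      exact (gap (by rw [hm.vee₁_eq_max, max_eq_left hle])).le
  have hsub : ker m ⊆ ker s₁ := by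
    intro x hxm
    have hxm' : m x = 1 := hxm
    rw [hx] at hxm'
    have g2 := mul_nonneg (sub_nonneg.2 ht'.le) (sub_nonneg.2 (hs₂.le_one x))
    refine le_antisymm (hs₁.le_one x) (le_of_mul_le_mul_left ?_ ht)
    linarith
  refine hm.eq_of_ker_eq (hs₁.isStateMorphism_of_vee₁_eq_max hmax) ?_
  by_contra hne
  exact hm.isMaximalFilter_ker.maximal _ hs₁.isFilter_ker hs₁.ker_ne_univ
    (hsub.ssubset_of_ne hne)

theorem isExtremalBosbachState (hm : IsStateMorphism m) : IsExtremalBosbachState m where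
  isBosbachState := hm.isBosbachState
  extremal t s₁ s₂ ht ht' hs₁ hs₂ h :=
    (hm.eq_of_convexCombination ht ht' hs₁ hs₂ h).symm.trans
      (hm.eq_of_convexCombination (sub_pos.2 ht') (by linarith) hs₂ hs₁
        (by rw [sub_sub_cancel, add_comm, h]))

end IsStateMorphism

end PseudoBCKAlgebra

theorem mainTheorem3 {A : Type*} [BoundedPseudoBCKAlgebra A] :
    (∀ s : A → ℝ, PseudoBCKAlgebra.IsBosbachState s →
      List.TFAE [
        PseudoBCKAlgebra.IsExtremalBosbachState s,
        ∀ x y : A, s (PseudoBCKAlgebra.vee₁ x y) = max (s x) (s y),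
        ∀ x y : A, s (PseudoBCKAlgebra.vee₂ x y) = max (s x) (s y),
        PseudoBCKAlgebra.IsStateMorphism s,
        PseudoBCKAlgebra.IsMaximalFilter (PseudoBCKAlgebra.ker s)]) ∧
    (∀ s : A → ℝ, PseudoBCKAlgebra.IsExtremalBosbachState s ↔
      PseudoBCKAlgebra.IsStateMorphism s) := by
  refine ⟨fun s hs => ?_, fun s => ⟨fun h =>
    h.isBosbachState.isStateMorphism_of_vee₁_eq_max h.vee₁_eq_max,
    fun h => h.isExtremalBosbachState⟩⟩
  tfae_have 1 → 2 := fun h => h.vee₁_eq_max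
  tfae_have 2 ↔ 3 := by simp only [hs.vee₁_eq_vee₂]
  tfae_have 2 → 4 := hs.isStateMorphism_of_vee₁_eq_max
  tfae_have 4 → 1 := fun h => h.isExtremalBosbachState
  tfae_have 4 → 5 := fun h => h.isMaximalFilter_ker
  tfae_have 5 → 2 := hs.vee₁_eq_max_of_isMaximalFilter_ker
  tfae_finish
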